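/- A decompressor is a computable partial function $D$ from $\{0,1\}^*$ to $\{0,1\}^*$. For a string $x$ put $C_D(x)=\min\{|y| : D(y)=x\}$, with $C_D(x)=\infty$ if there is no such $y$. $D$ is prefix-free if it is never defined on both of two different strings one of which is a prefix of the other. A prefix-free decompressor $D$ is called optimal if for every prefix-free decompressor $D'$ there is a constant $c$ such that $C_D(x)\le C_{D'}(x)+c$ for all $x\in\{0,1\}^*$. Lemma 1. There exists a decidable set $A\subseteq\{0,1\}^*$ with the following two properties: (1) for every $n\ge 0$, the set $A$ contains at least $\frac13 2^n$ of the $2^n$ strings of length $n$; (2) there is no optimal prefix-free decompressor whose domain is a subset of $A$. -/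

import Mathlib

/-- The Kolmogorov complexity of `x` with respect to a partial function `D` on binary strings:
the length of a shortest `y` with `D y = x`, and `⊤` if there is no such `y`. -/
noncomputable def descComplexity (D : List Bool →. List Bool) (x : List Bool) : ℕ∞ :=
  ⨅ y ∈ {y : List Bool | x ∈ D y}, (y.length : ℕ∞)

/-- A prefix-free decompressor: a computable partial function on binary strings
that is never defined on both a string and a proper prefix of that string. -/
structure IsPrefixFreeDecompressor (D : List Bool →. List Bool) : Prop where
  partrec : Partrec D
  prefixFree : ∀ u ∈ D.Dom, ∀ v ∈ D.Dom, u <+: v → u = v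

/-- An optimal prefix-free decompressor: its complexity function is minimal, up to an additive
constant, among those of all prefix-free decompressors. -/
structure IsOptimalPrefixFreeDecompressor (D : List Bool →. List Bool) : Prop where
  isPrefixFreeDecompressor : IsPrefixFreeDecompressor D
  optimal : ∀ D' : List Bool →. List Bool, IsPrefixFreeDecompressor D' →
    ∃ c : ℕ, ∀ x : List Bool, descComplexity D x ≤ descComplexity D' x + c

/-! Lengths are cut into blocks of increasing width. In block `i` the set keeps the strings
extending half of the strings of one short length, prescribed by `pattern i`; every half recurs
infinitely often. Suppose an optimal `D` has domain `T` inside this set. Counting descriptions shows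
that `T` meets every late block. Call a string free if it is not a proper prefix of an element of
`T`. If more than half of the strings of length `m` were free, a late block whose pattern is half of
`2 ^ m` strings, all free, would contradict `T` meeting it (`two_mul_card_freeStrings_le`). So
patterns made of non-free strings exist. The density of free strings grows to a limit; with `m`
close to that limit, a late block with such a pattern is almost entirely blocked: its strings at the
top length are outside the set or, with few exceptions, not free
(`exists_two_pow_le_card_filter_isBlocked`). Blocking is semi-decidable, so for each `c` such a
block can be found effectively. By prefix-freeness few elements of `T` lie in it
(`card_add_card_le_of_isBlocked`), and shorter strings are negligible. Requesting many descriptions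
of about its top length then contradicts optimality (`exists_pow_le_card`). -/

open Nat.Partrec (Code)
open Encodable

/-! ### Counting binary strings -/

/-- The finite set of binary strings of length `n`. -/
def bitStrings (n : ℕ) : Finset (List Bool) :=
  (Finset.univ : Finset (List.Vector Bool n)).map ⟨List.Vector.toList, Subtype.val_injective⟩

@[simp] theorem mem_bitStrings {n : ℕ} {x : List Bool} : x ∈ bitStrings n ↔ x.length = n := by
  constructor
  · intro h
    obtain ⟨v, -, rfl⟩ := Finset.mem_map.1 h
    exact v.2
  · intro h
    exact Finset.mem_map.2 ⟨⟨x, h⟩, Finset.mem_univ _, rfl⟩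

@[simp] theorem card_bitStrings (n : ℕ) : (bitStrings n).card = 2 ^ n := by
  rw [bitStrings, Finset.card_map, Finset.card_univ, card_vector, Fintype.card_bool]

/-- The finite set of binary strings of length less than `n`. -/
def shortBitStrings (n : ℕ) : Finset (List Bool) :=
  (Finset.range n).biUnion bitStrings

@[simp] theorem mem_shortBitStrings {n : ℕ} {x : List Bool} :
    x ∈ shortBitStrings n ↔ x.length < n := by
  simp [shortBitStrings]

theorem card_shortBitStrings_lt (n : ℕ) : (shortBitStrings n).card < 2 ^ n := by
  have h : (shortBitStrings n).card ≤ ∑ k ∈ Finset.range n, 2 ^ k :=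
    Finset.card_biUnion_le.trans (by simp)
  have h' := Nat.geomSum_lt (m := 2) (n := n) (s := Finset.range n) le_rfl (by simp)
  omega

theorem card_filter_take_mem {m q : ℕ} (hmq : m ≤ q) {Q : Finset (List Bool)}
    (hQ : ∀ u ∈ Q, u.length = m) :
    ((bitStrings q).filter fun z => z.take m ∈ Q).card = Q.card * 2 ^ (q - m) := by
  rw [← card_bitStrings (q - m), ← Finset.card_product]
  refine Finset.card_nbij' (fun z => (z.take m, z.drop m)) (fun p => p.1 ++ p.2) ?_ ?_ ?_ ?_
  · intro z hz
    simp at hz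
    simp [hz.1, hz.2]
  · rintro ⟨u, w⟩ hz
    simp at hz
    have := hQ u hz.1
    simp [hz, this]
    omega
  · intro z hz
    simp
  · rintro ⟨u, w⟩ hz
    simp at hz
    have := hQ u hz.1
    simp [← this]

theorem isPrefix_iff_take_eq {u z : List Bool} {m : ℕ} (hu : u.length = m) :
    u <+: z ↔ z.take m = u := by
  rw [List.prefix_iff_eq_take, hu, eq_comm]

theorem exists_mem_isPrefix_iff {Q : List (List Bool)} {m : ℕ} (hQ : ∀ u ∈ Q, u.length = m)
    {z : List Bool} : (∃ u ∈ Q, u <+: z) ↔ z.take m ∈ Q := by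
  constructor
  · rintro ⟨u, hu, huz⟩
    rwa [(isPrefix_iff_take_eq (hQ u hu)).1 huz]
  · exact fun h => ⟨_, h, List.take_prefix _ _⟩

/-! ### Prefix-free decompressors built from length requests -/

/-- The identity restricted to the strings `1ᵏ0w` whose total length is `h k`. -/
def taggedIdentity (h : ℕ →. ℕ) : List Bool →. List Bool := fun s =>
  (h (s.idxOf false)).bind fun l =>
    ((if s.idxOf false < s.length ∧ s.length = l then some s else none : Option (List Bool)) :
      Part (List Bool))

theorem mem_taggedIdentity {h : ℕ →. ℕ} {s x : List Bool} :
    x ∈ taggedIdentity h s ↔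
      s.idxOf false < s.length ∧ s.length ∈ h (s.idxOf false) ∧ x = s := by
  simp only [taggedIdentity, Part.mem_bind_iff, Part.mem_ofOption]
  constructor
  · rintro ⟨l, hl, hx⟩
    split_ifs at hx with hc
    · simp at hx
      exact ⟨hc.1, hc.2 ▸ hl, hx.symm⟩
    · simp at hx
  · rintro ⟨h1, h2, rfl⟩
    exact ⟨_, h2, by simp [h1]⟩

/-- The tag `1ᵏ0` fixes the total length, so comparable strings of the domain have equal length.
Since `idxOf` returns the length when `false` is absent, the strict inequality guarantees a complete
tag. -/
theorem isPrefixFreeDecompressor_taggedIdentity {h : ℕ →. ℕ} (hh : Partrec h) :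
    IsPrefixFreeDecompressor (taggedIdentity h) where
  partrec := by
    have hidx : Primrec fun s : List Bool => s.idxOf false :=
      Primrec.list_idxOf.comp (Primrec.const false) Primrec.id
    refine (hh.comp hidx.to_comp).bind (Computable.ofOption ?_)
    refine Primrec.to_comp ?_
    refine Primrec.ite (PrimrecPred.and ?_ ?_) (Primrec.option_some.comp Primrec.fst)
      (Primrec.const none)
    · exact Primrec.nat_lt.comp (hidx.comp Primrec.fst) (Primrec.list_length.comp Primrec.fst)
    · exact Primrec.eq.comp (Primrec.list_length.comp Primrec.fst) Primrec.snd
  prefixFree := by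
    intro u hu v hv huv
    obtain ⟨x, hx⟩ := Part.dom_iff_mem.1 hu
    obtain ⟨y, hy⟩ := Part.dom_iff_mem.1 hv
    obtain ⟨hu1, hu2, -⟩ := mem_taggedIdentity.1 hx
    obtain ⟨-, hv2, -⟩ := mem_taggedIdentity.1 hy
    obtain ⟨w, rfl⟩ := huv
    rw [List.idxOf_append_of_mem (List.idxOf_lt_length_iff.1 hu1)] at hv2
    have := Part.mem_unique hu2 hv2
    simpa using this

theorem descComplexity_taggedIdentity_le {h : ℕ →. ℕ} {k l : ℕ} (hl : l ∈ h k) (hkl : k < l)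
    {w : List Bool} (hw : w.length = l - k - 1) :
    descComplexity (taggedIdentity h) (List.replicate k true ++ false :: w) ≤ l := by
  have hlen : (List.replicate k true ++ false :: w).length = l := by
    simp [hw]; omega
  have hidx : (List.replicate k true ++ false :: w).idxOf false = k := by
    rw [List.idxOf_append_of_notMem (by simp)]
    simp
  refine (iInf₂_le (List.replicate k true ++ false :: w) ?_).trans (by rw [hlen])
  refine mem_taggedIdentity.2 ?_
  rw [hidx, hlen]
  exact ⟨hkl, hl, rfl⟩

theorem exists_length_le_of_descComplexity_le {D : List Bool →. List Bool} {x : List Bool} {n : ℕ}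
    (h : descComplexity D x ≤ n) : ∃ y, x ∈ D y ∧ y.length ≤ n := by
  by_contra! hc
  have : ((n + 1 : ℕ) : ℕ∞) ≤ descComplexity D x :=
    le_iInf₂ fun y hy => by exact_mod_cast hc y hy
  have h' := this.trans h
  norm_cast at h'
  omega

/-- An optimal decompressor answers all requests `1ᵏ0w` of a fixed length `h k` by different
strings of almost that length. -/
theorem IsOptimalPrefixFreeDecompressor.exists_pow_le_card {D : List Bool →. List Bool}
    (hD : IsOptimalPrefixFreeDecompressor D) {h : ℕ →. ℕ} (hh : Partrec h) :
    ∃ c : ℕ, ∀ k l, l ∈ h k → k < l → ∀ B : Finset (List Bool),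
      (∀ y ∈ D.Dom, y.length ≤ l + c → y ∈ B) → 2 ^ (l - k - 1) ≤ B.card := by
  obtain ⟨c, hc⟩ := hD.optimal _ (isPrefixFreeDecompressor_taggedIdentity hh)
  refine ⟨c, fun k l hl hkl B hB => ?_⟩
  have key : ∀ w ∈ bitStrings (l - k - 1),
      ∃ y, (List.replicate k true ++ false :: w) ∈ D y ∧ y.length ≤ l + c := by
    intro w hw
    refine exists_length_le_of_descComplexity_le ((hc _).trans ?_)
    push_cast
    gcongr
    exact descComplexity_taggedIdentity_le hl hkl (mem_bitStrings.1 hw)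
  choose! f hf using key
  rw [← card_bitStrings]
  refine Finset.card_le_card_of_injOn f
    (fun w hw => hB _ (Part.dom_iff_mem.2 ⟨_, (hf w hw).1⟩) (hf w hw).2) ?_
  intro w hw w' hw' hww
  have h1 := (hf w hw).1
  rw [hww] at h1
  simpa using Part.mem_unique h1 (hf w' hw').1

/-! ### Search for certificates -/

/-- Unbounded search through all codes; it will be used to find certificates. -/
theorem exists_partrec_selector {γ : Type*} [Primcodable γ] {R : ℕ → γ → Prop}
    (hR : PrimrecRel R) : ∃ g : ℕ →. γ, Partrec g ∧ (∀ c, (∃ p, R c p) → ∃ p, p ∈ g c) ∧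
      ∀ c, ∀ p ∈ g c, R c p := by
  classical
  refine ⟨fun c => Nat.rfindOpt fun k => (decode (α := γ) k).bind fun p =>
    if R c p then some p else none, Partrec.rfindOpt ?_, ?_, ?_⟩
  · refine Primrec.to_comp ?_
    refine Primrec.option_bind (Primrec.decode.comp Primrec.snd) ?_
    exact Primrec.ite (hR.comp (Primrec.fst.comp Primrec.fst) Primrec.snd)
      (Primrec.option_some.comp Primrec.snd) (Primrec.const none)
  · rintro c ⟨p, hp⟩
    rw [← Part.dom_iff_mem, Nat.rfindOpt_dom]
    exact ⟨encode p, p, by simp [hp]⟩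
  · intro c p hp
    obtain ⟨k, hk⟩ := Nat.rfindOpt_spec hp
    simp only [Option.mem_def, Option.bind_eq_some_iff] at hk
    obtain ⟨p', -, hp'⟩ := hk
    split_ifs at hp' with h
    · simp at hp'
      exact hp' ▸ h

theorem Partrec.exists_code_dom_iff {α σ : Type*} [Primcodable α] [Primcodable σ] {f : α →. σ}
    (hf : Partrec f) : ∃ e : Code, ∀ a, a ∈ f.Dom ↔ ∃ t, (e.evaln t (encode a)).isSome := by
  obtain ⟨e, he⟩ := Code.exists_code.1 hf
  refine ⟨e, fun a => ?_⟩
  have h : (e.eval (encode a)).Dom ↔ (f a).Dom := by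
    rw [he]; simp
  rw [PFun.mem_dom, ← Part.dom_iff_mem, ← h, Part.dom_iff_mem]
  simp only [Code.evaln_complete, Option.isSome_iff_exists, Option.mem_def]
  exact exists_comm

/-- Turns `Nodup` into an equation between primitive recursive functions of the list. -/
theorem List.nodup_iff_map_idxOf_eq_range {α : Type*} [DecidableEq α] (l : List α) :
    l.Nodup ↔ l.map (fun a => l.idxOf a) = List.range l.length := by
  constructor
  · intro h
    refine List.ext_getElem (by simp) fun i hi hi' => ?_
    simp [h.idxOf_getElem]
  · intro h
    exact List.Nodup.of_map (fun a => l.idxOf a) (h ▸ List.nodup_range)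

theorem PrimrecPred.list_nodup {α : Type*} [Primcodable α] [DecidableEq α] :
    PrimrecPred fun l : List α => l.Nodup :=
  (Primrec.eq.comp
    (Primrec.list_map Primrec.id (Primrec.list_idxOf.comp Primrec.snd Primrec.fst).to₂)
    (Primrec.list_range.comp Primrec.list_length)).of_eq
    fun l => (l.nodup_iff_map_idxOf_eq_range).symm

theorem PrimrecRel.list_isPrefix {α : Type*} [Primcodable α] :
    PrimrecRel fun u v : List α => u <+: v :=
  (Primrec.eq.comp Primrec.fst (Primrec.list_take.comp
    (Primrec.list_length.comp Primrec.fst) Primrec.snd)).of_eq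
    fun _ => List.prefix_iff_eq_take.symm

theorem Primrec.two_pow : Primrec fun n : ℕ => 2 ^ n :=
  (Primrec.nat_rec₁ 1 (Primrec.nat_double.comp Primrec.snd).to₂).of_eq fun n => by
    induction n with
    | zero => rfl
    | succ n ih => rw [pow_succ, ← ih, mul_comm]

/-! ### Blocks of lengths and the set `patternSet` -/

/-- The least length in block `i`. -/
def blockMin (i : ℕ) : ℕ := 4 * (i * i)

/-- The greatest length in block `i`. -/
def blockMax (i : ℕ) : ℕ := 4 * (i * i) + 8 * i + 3

/-- The block containing the length `n`. -/
def blockIndex (n : ℕ) : ℕ := n.sqrt / 2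

theorem blockIndex_eq_iff {n i : ℕ} : blockIndex n = i ↔ blockMin i ≤ n ∧ n ≤ blockMax i := by
  unfold blockIndex blockMin blockMax
  have h1 : 2 * i ≤ n.sqrt ↔ 4 * (i * i) ≤ n := by
    rw [Nat.le_sqrt]; ring_nf
  have h2 : n.sqrt < 2 * i + 2 ↔ n < 4 * (i * i) + 8 * i + 4 := by
    rw [Nat.sqrt_lt]; ring_nf
  omega

theorem le_blockMin (i : ℕ) : i ≤ blockMin i := by
  unfold blockMin
  nlinarith [Nat.le_mul_self i]

theorem primrec_blockIndex : Primrec blockIndex :=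
  Primrec.nat_div.comp Primrec.nat_sqrt (Primrec.const 2)

theorem primrec_blockMin : Primrec blockMin :=
  Primrec.nat_mul.comp (Primrec.const 4) (Primrec.nat_mul.comp Primrec.id Primrec.id)

theorem primrec_blockMax : Primrec blockMax :=
  Primrec.nat_add.comp (Primrec.nat_add.comp primrec_blockMin
    (Primrec.nat_mul.comp (Primrec.const 8) Primrec.id)) (Primrec.const 3)

/-- An enumeration of all pairs of a length and a list of strings in which each pair occurs
infinitely often. -/
def pattern (i : ℕ) : ℕ × List (List Bool) := (decode i.unpair.1).getD (0, [])

theorem exists_pattern_eq (p : ℕ × List (List Bool)) (K : ℕ) : ∃ i ≥ K, pattern i = p :=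
  ⟨Nat.pair (encode p) K, Nat.right_le_pair _ _, by simp [pattern]⟩

/-- `p.2` lists half of the strings of length `p.1`. -/
def IsBalanced (p : ℕ × List (List Bool)) : Prop :=
  p.2.Nodup ∧ (∀ u ∈ p.2, u.length = p.1) ∧ 2 * p.2.length = 2 ^ p.1

/-- The strings whose length lies in a block `i` and which have a prefix in `pattern i`, whenever
`pattern i` is balanced and consists of strings that are short enough. -/
def patternSet : Set (List Bool) :=
  {x | IsBalanced (pattern (blockIndex x.length)) →
    (pattern (blockIndex x.length)).1 ≤ blockMin (blockIndex x.length) →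
    ∃ u ∈ (pattern (blockIndex x.length)).2, u <+: x}

theorem mem_patternSet_iff {x : List Bool} {i : ℕ} (hb : IsBalanced (pattern i))
    (hm : (pattern i).1 ≤ blockMin i) (hx : blockIndex x.length = i) :
    x ∈ patternSet ↔ x.take (pattern i).1 ∈ (pattern i).2 := by
  subst hx
  simp only [patternSet, Set.mem_ofPred_eq, hb, hm, true_imp_iff]
  exact exists_mem_isPrefix_iff hb.2.1

/-- Membership in `patternSet` depends only on the block and on a prefix. -/
theorem append_mem_patternSet {y w : List Bool} (hy : y ∈ patternSet)
    (h : blockIndex (y ++ w).length = blockIndex y.length) : y ++ w ∈ patternSet := by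
  intro hb hm
  rw [h] at hb hm ⊢
  obtain ⟨u, hu, huy⟩ := hy hb hm
  exact ⟨u, hu, huy.trans (List.prefix_append _ _)⟩

theorem primrecPred_mem_patternSet : PrimrecPred fun x : List Bool => x ∈ patternSet := by
  have hpat : Primrec pattern :=
    Primrec.option_getD.comp (Primrec.decode.comp (Primrec.fst.comp Primrec.unpair))
      (Primrec.const (0, []))
  have hbal : PrimrecPred IsBalanced :=
    (PrimrecPred.list_nodup.comp Primrec.snd).and <| PrimrecPred.and
      ((PrimrecRel.forall_mem_list (R := fun (u : List Bool) (m : ℕ) => u.length = m)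
        (Primrec.eq.comp (Primrec.list_length.comp Primrec.fst) Primrec.snd)).comp
          Primrec.snd Primrec.fst)
      (Primrec.eq.comp (Primrec.nat_double.comp (Primrec.list_length.comp Primrec.snd))
        (Primrec.two_pow.comp Primrec.fst))
  have hidx : Primrec fun x : List Bool => blockIndex x.length :=
    primrec_blockIndex.comp Primrec.list_length
  have hpx : Primrec fun x : List Bool => pattern (blockIndex x.length) := hpat.comp hidx
  have h1 := (hbal.comp hpx).not
  have h2 := (Primrec.nat_le.comp (Primrec.fst.comp hpx) (primrec_blockMin.comp hidx)).not
  have h3 := (PrimrecRel.exists_mem_list (R := fun (u x : List Bool) => u <+: x)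
    PrimrecRel.list_isPrefix).comp (Primrec.snd.comp hpx) Primrec.id
  refine (h1.or (h2.or h3)).of_eq fun x => ?_
  simp only [patternSet, Set.mem_ofPred_eq, id]
  tauto

theorem third_le_ncard_patternSet (n : ℕ) :
    (1 / 3 : ℝ) * 2 ^ n ≤ ({x : List Bool | x ∈ patternSet ∧ x.length = n}.ncard : ℝ) := by
  classical
  have heq : {x : List Bool | x ∈ patternSet ∧ x.length = n} =
      ((bitStrings n).filter (· ∈ patternSet) : Finset (List Bool)) := by
    ext x; simp [and_comm]
  rw [heq, Set.ncard_coe_finset]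
  -- The construction gives density at least `1 / 2`, more than the required third.
  suffices h : 2 ^ n ≤ 2 * ((bitStrings n).filter (· ∈ patternSet)).card by
    have h' : (2 : ℝ) ^ n ≤ 2 * (((bitStrings n).filter (· ∈ patternSet)).card : ℝ) := by
      exact_mod_cast h
    have : (0 : ℝ) < 2 ^ n := by positivity
    linarith
  set i := blockIndex n with hi
  by_cases hb : IsBalanced (pattern i) ∧ (pattern i).1 ≤ blockMin i
  · obtain ⟨hbal, hm⟩ := hb
    obtain ⟨hnd, hlen, hcard⟩ := hbal
    have hmn : (pattern i).1 ≤ n := hm.trans (blockIndex_eq_iff.1 hi.symm).1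
    have hfil : (bitStrings n).filter (· ∈ patternSet) =
        (bitStrings n).filter fun z => z.take (pattern i).1 ∈ (pattern i).2.toFinset := by
      refine Finset.filter_congr fun z hz => ?_
      rw [List.mem_toFinset]
      exact mem_patternSet_iff ⟨hnd, hlen, hcard⟩ hm (by rw [mem_bitStrings.1 hz])
    rw [hfil, card_filter_take_mem hmn (by simpa using hlen), List.toFinset_card_of_nodup hnd,
      ← mul_assoc, hcard, ← pow_add, Nat.add_sub_cancel' hmn]
  · have hfil : (bitStrings n).filter (· ∈ patternSet) = bitStrings n := by
      refine Finset.filter_true_of_mem fun z hz h1 h2 => (hb ?_).elim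
      rw [mem_bitStrings.1 hz] at h1 h2
      exact ⟨h1, h2⟩
    rw [hfil, card_bitStrings]
    omega

/-! ### Strings without extensions in a set -/

/-- `z` is a proper prefix of an element of `T`. -/
def HasStrictExtension (T : Set (List Bool)) (z : List Bool) : Prop :=
  ∃ y ∈ T, z <+: y ∧ z ≠ y

theorem HasStrictExtension.of_isPrefix {T : Set (List Bool)} {u z : List Bool}
    (hz : HasStrictExtension T z) (huz : u <+: z) : HasStrictExtension T u := by
  obtain ⟨y, hy, hzy, hne⟩ := hz
  refine ⟨y, hy, huz.trans hzy, ?_⟩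
  rintro rfl
  exact hne (hzy.eq_of_length_le huz.length_le)

open Classical in
/-- The strings of length `m` that are not proper prefixes of elements of `T`. -/
noncomputable def freeStrings (T : Set (List Bool)) (m : ℕ) : Finset (List Bool) :=
  (bitStrings m).filter fun z => ¬ HasStrictExtension T z

theorem mem_freeStrings {T : Set (List Bool)} {m : ℕ} {z : List Bool} :
    z ∈ freeStrings T m ↔ z.length = m ∧ ¬ HasStrictExtension T z := by
  simp [freeStrings]

theorem freeStrings_subset (T : Set (List Bool)) (m : ℕ) : freeStrings T m ⊆ bitStrings m :=
  fun _ hz => mem_bitStrings.2 (mem_freeStrings.1 hz).1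

/-- Extensions of free strings stay free, and `U` collects further free strings that do not arise in
this way. -/
theorem card_freeStrings_add_le {T : Set (List Bool)} {m q : ℕ} (hmq : m ≤ q)
    {U : Finset (List Bool)} (hU : U ⊆ freeStrings T q)
    (hUm : ∀ z ∈ U, z.take m ∉ freeStrings T m) :
    (freeStrings T m).card * 2 ^ (q - m) + U.card ≤ (freeStrings T q).card := by
  rw [← card_filter_take_mem hmq fun u hu => (mem_freeStrings.1 hu).1,
    ← Finset.card_union_of_disjoint]
  · refine Finset.card_le_card (Finset.union_subset (fun z hz => ?_) hU)
    rw [Finset.mem_filter, mem_bitStrings] at hz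
    exact mem_freeStrings.2 ⟨hz.1, fun h =>
      (mem_freeStrings.1 hz.2).2 (h.of_isPrefix (List.take_prefix _ _))⟩
  · exact Finset.disjoint_left.2 fun z hz hzU => hUm z hzU (Finset.mem_filter.1 hz).2

/-- The density of the free strings increases with the length, so it is nearly constant from some
length on. -/
theorem exists_card_freeStrings_le (T : Set (List Bool)) (e : ℕ) :
    ∃ m ≥ 1, ∀ q ≥ m, e ≤ q →
      (freeStrings T q).card ≤ (freeStrings T m).card * 2 ^ (q - m) + 2 ^ (q - e) := by
  set f : ℕ → ℝ := fun m => (freeStrings T m).card / 2 ^ m with hf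
  have hpow : ∀ m q : ℕ, m ≤ q → (2 : ℝ) ^ q = 2 ^ (q - m) * 2 ^ m := fun m q h => by
    rw [← pow_add, Nat.sub_add_cancel h]
  have hmono : Monotone f := by
    intro m q hmq
    have h := card_freeStrings_add_le (T := T) hmq (Finset.empty_subset _) (by simp)
    rw [Finset.card_empty, add_zero] at h
    simp only [hf]
    rw [div_le_div_iff₀ (by positivity) (by positivity), hpow m q hmq, ← mul_assoc]
    gcongr
    exact_mod_cast h
  have hbdd : BddAbove (Set.range f) := by
    refine ⟨1, ?_⟩
    rintro _ ⟨m, rfl⟩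
    have h := Finset.card_le_card (freeStrings_subset T m)
    rw [card_bitStrings] at h
    rw [div_le_one (by positivity)]
    exact_mod_cast h
  have he0 : (0 : ℝ) < 1 / 2 ^ e := by positivity
  obtain ⟨m, hm⟩ := exists_lt_of_lt_ciSup (sub_lt_self (iSup f) he0)
  -- Passing to `m + 1` makes the length positive, so that half of `2 ^ m` is an integer later.
  refine ⟨m + 1, by omega, fun q hq he => ?_⟩
  have h1 : f q ≤ f (m + 1) + 1 / 2 ^ e := by
    have hsup : f q ≤ iSup f := le_ciSup hbdd q
    have hstep : f m ≤ f (m + 1) := hmono (Nat.le_succ m)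
    linarith
  simp only [hf] at h1
  rw [div_le_iff₀ (by positivity), add_mul, div_mul_eq_mul_div, div_mul_eq_mul_div, one_mul,
    hpow _ q hq, ← mul_assoc, mul_div_cancel_right₀ _ (by positivity), ← hpow _ q hq, hpow _ q he,
    mul_div_cancel_right₀ _ (by positivity)] at h1
  exact_mod_cast h1

/-! ### Blocked strings -/

/-- `z` is outside `patternSet` or a proper prefix of an element of `T`. -/
def IsBlocked (T : Set (List Bool)) (z : List Bool) : Prop :=
  z ∉ patternSet ∨ HasStrictExtension T z

/-- If `T` meets all late blocks, then at most half of the strings of any positive length are free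
of extensions in `T`. -/
theorem two_mul_card_freeStrings_le {T : Set (List Bool)} (hT : T ⊆ patternSet) {K : ℕ}
    (hK : ∀ i ≥ K, ∃ y ∈ T, blockIndex y.length = i) {m : ℕ} (hm : 1 ≤ m) :
    2 * (freeStrings T m).card ≤ 2 ^ m := by
  by_contra! hlt
  have hpow : 2 * 2 ^ (m - 1) = 2 ^ m := by rw [← pow_succ', Nat.sub_add_cancel hm]
  obtain ⟨Q, hQ, hcard⟩ := Finset.exists_subset_card_eq
    (show 2 ^ (m - 1) ≤ (freeStrings T m).card by omega)
  -- Block `i` is late enough to meet `T`, and its lengths exceed `m`, so the prefix in `Q` is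
  -- proper.
  obtain ⟨i, hi, hpat⟩ := exists_pattern_eq (m, Q.toList) (max K (m + 1))
  have hmi : m < blockMin i := lt_of_lt_of_le (by omega) (le_blockMin i)
  have hbal : IsBalanced (pattern i) := by
    rw [hpat]
    refine ⟨Q.nodup_toList, fun u hu => (mem_freeStrings.1 (hQ (Finset.mem_toList.1 hu))).1, ?_⟩
    simp [hcard, hpow]
  obtain ⟨y, hy, hyi⟩ := hK i (by omega)
  have h := (mem_patternSet_iff hbal (by rw [hpat]; exact hmi.le) hyi).1 (hT hy)
  rw [hpat, Finset.mem_toList] at h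
  refine (mem_freeStrings.1 (hQ h)).2 ⟨y, hy, List.take_prefix _ _, fun heq => ?_⟩
  have hlen := (mem_freeStrings.1 (hQ h)).1
  rw [heq] at hlen
  have := (blockIndex_eq_iff.1 hyi).1
  omega

open Classical in
/-- If `T` meets all late blocks, then in some late block almost all strings of maximal length are
blocked. -/
theorem exists_two_pow_le_card_filter_isBlocked {T : Set (List Bool)} (hT : T ⊆ patternSet) {K : ℕ}
    (hK : ∀ i ≥ K, ∃ y ∈ T, blockIndex y.length = i) (N e : ℕ) :
    ∃ i ≥ N, 2 ^ blockMax i ≤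
      ((bitStrings (blockMax i)).filter (IsBlocked T)).card + 2 ^ (blockMax i - e) := by
  obtain ⟨m, hm, hgap⟩ := exists_card_freeStrings_le T e
  have hhalf := two_mul_card_freeStrings_le hT hK hm
  have hpow : 2 * 2 ^ (m - 1) = 2 ^ m := by rw [← pow_succ', Nat.sub_add_cancel hm]
  obtain ⟨Q, hQ, hcard⟩ := Finset.exists_subset_card_eq
    (show 2 ^ (m - 1) ≤ (bitStrings m \ freeStrings T m).card by
      rw [Finset.card_sdiff_of_subset (freeStrings_subset T m), card_bitStrings]
      omega)
  obtain ⟨i, hi, hpat⟩ := exists_pattern_eq (m, Q.toList) (max N (max m e))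
  have hmi : max m e ≤ blockMin i := le_trans (by omega) (le_blockMin i)
  have hminmax : blockMin i ≤ blockMax i := by unfold blockMin blockMax; omega
  have hbal : IsBalanced (pattern i) := by
    rw [hpat]
    refine ⟨Q.nodup_toList, fun u hu => ?_, by simp [hcard, hpow]⟩
    exact mem_bitStrings.1 (Finset.sdiff_subset (hQ (Finset.mem_toList.1 hu)))
  refine ⟨i, by omega, ?_⟩
  set q := blockMax i with hq
  have hqi : blockIndex q = i := blockIndex_eq_iff.2 ⟨hminmax, le_rfl⟩
  -- An unblocked string is free at length `q`, while its prefix lies in `Q` and is not free at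
  -- length `m`. Such strings add to the free density, which grows by at most `2 ^ -e`.
  have hU := card_freeStrings_add_le (T := T) (m := m) (q := q) (by omega)
    (U := (bitStrings q).filter fun z => ¬ IsBlocked T z)
    (fun z hz => by
      rw [Finset.mem_filter, mem_bitStrings] at hz
      exact mem_freeStrings.2 ⟨hz.1, fun h => hz.2 (Or.inr h)⟩)
    (fun z hz => by
      rw [Finset.mem_filter, mem_bitStrings] at hz
      have hzA : z ∈ patternSet := by
        by_contra h
        exact hz.2 (Or.inl h)
      have h := (mem_patternSet_iff hbal (by rw [hpat]; dsimp only; omega)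
        (by rw [hz.1, hqi])).1 hzA
      rw [hpat, Finset.mem_toList] at h
      exact (Finset.mem_sdiff.1 (hQ h)).2)
  have hgap' := hgap q (by omega) (by omega)
  have hsum := Finset.card_filter_add_card_filter_not (s := bitStrings q) (IsBlocked T)
  rw [card_bitStrings] at hsum
  omega

/-- A prefix-free set contains at most as many strings of block `i` as there are unblocked strings
of the maximal length in that block. -/
theorem card_add_card_le_of_isBlocked {T : Set (List Bool)} (hT : T ⊆ patternSet)
    (hfree : ∀ u ∈ T, ∀ v ∈ T, u <+: v → u = v) {i : ℕ} {S Y : Finset (List Bool)}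
    (hS : ∀ y ∈ S, y ∈ T ∧ blockIndex y.length = i)
    (hY : ∀ z ∈ Y, z.length = blockMax i ∧ IsBlocked T z) :
    S.card + Y.card ≤ 2 ^ blockMax i := by
  classical
  -- Padding to the top length is injective on `S` and yields unblocked strings, both by
  -- prefix-freeness of `T`; padding stays in `patternSet` because the block does not change.
  set pad : List Bool → List Bool :=
    fun y => y ++ List.replicate (blockMax i - y.length) false with hpad
  have hlen : ∀ y ∈ S, (pad y).length = blockMax i := fun y hy => by
    have := (blockIndex_eq_iff.1 (hS y hy).2).2
    simp only [hpad, List.length_append, List.length_replicate]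
    omega
  have hidx : blockIndex (blockMax i) = i :=
    blockIndex_eq_iff.2 ⟨by unfold blockMin blockMax; omega, le_rfl⟩
  have hinj : Set.InjOn pad S := by
    intro y hy y' hy' h
    have h1 : y <+: pad y := List.prefix_append _ _
    have h2 : y' <+: pad y := by rw [h]; exact List.prefix_append _ _
    rcases List.prefix_or_prefix_of_prefix h1 h2 with h3 | h3
    · exact hfree _ (hS y hy).1 _ (hS y' hy').1 h3
    · exact (hfree _ (hS y' hy').1 _ (hS y hy).1 h3).symm
  have hdisj : Disjoint (S.image pad) Y := by
    refine Finset.disjoint_left.2 fun z hz hzY => ?_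
    obtain ⟨y, hy, rfl⟩ := Finset.mem_image.1 hz
    rcases (hY _ hzY).2 with h | ⟨v, hv, hzv, hne⟩
    · refine h (append_mem_patternSet (hT (hS y hy).1) ?_)
      have := hlen y hy
      simp only [hpad] at this
      rw [this, hidx, (hS y hy).2]
    · have hyp : y <+: pad y := List.prefix_append _ _
      have := hfree _ (hS y hy).1 _ hv (hyp.trans hzv)
      subst this
      exact hne (hzv.eq_of_length_le hyp.length_le)
  rw [← Finset.card_image_of_injOn hinj, ← Finset.card_union_of_disjoint hdisj,
    ← card_bitStrings]
  refine Finset.card_le_card (Finset.union_subset ?_ fun z hz => mem_bitStrings.2 (hY z hz).1)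
  intro z hz
  obtain ⟨y, hy, rfl⟩ := Finset.mem_image.1 hz
  exact mem_bitStrings.2 (hlen y hy)

/-! ### Certificates for blocked strings -/

/-- `p = (i, t, Y)` witnesses that all but a fraction `2 ^ -(2 * c + 4)` of the strings of maximal
length in block `i` are blocked by the domain of the code `e`: for each blocked string in `Y` that
belongs to `patternSet`, an extension is given on which `e` halts within `t` steps. -/
def IsCertificate (e : Code) (c : ℕ) (p : ℕ × ℕ × List (List Bool × List Bool)) : Prop :=
  c < p.1 ∧ (p.2.2.map Prod.fst).Nodup ∧
    (∀ w ∈ p.2.2, w.1.length = blockMax p.1 ∧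
      (w.1 ∉ patternSet ∨
        w.1 <+: w.2 ∧ w.1 ≠ w.2 ∧ (e.evaln p.2.1 (encode w.2)).isSome)) ∧
    2 ^ blockMax p.1 ≤ p.2.2.length + 2 ^ (blockMax p.1 - (2 * c + 4))

theorem primrecRel_isCertificate (e : Code) : PrimrecRel (IsCertificate e) := by
  have hi : Primrec fun a : ℕ × ℕ × ℕ × List (List Bool × List Bool) => a.2.1 :=
    Primrec.fst.comp Primrec.snd
  have hY : Primrec fun a : ℕ × ℕ × ℕ × List (List Bool × List Bool) => a.2.2.2 :=
    Primrec.snd.comp (Primrec.snd.comp Primrec.snd)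
  have hR : PrimrecRel fun (w : List Bool × List Bool) (p : ℕ × ℕ) =>
      w.1.length = blockMax p.1 ∧ (w.1 ∉ patternSet ∨
        w.1 <+: w.2 ∧ w.1 ≠ w.2 ∧ (e.evaln p.2 (encode w.2)).isSome) := by
    have h1 : Primrec fun a : (List Bool × List Bool) × ℕ × ℕ => a.1.1 :=
      Primrec.fst.comp Primrec.fst
    have h2 : Primrec fun a : (List Bool × List Bool) × ℕ × ℕ => a.1.2 :=
      Primrec.snd.comp Primrec.fst
    have h3 : PrimrecPred fun a : (List Bool × List Bool) × ℕ × ℕ =>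
        ((e.evaln a.2.2 (encode a.1.2)).isSome : Prop) :=
      (Primrec.eq.comp (Primrec.option_isSome.comp (Code.primrec_evaln.comp
        (((Primrec.snd.comp Primrec.snd).pair (Primrec.const e)).pair
          (Primrec.encode.comp h2)))) (Primrec.const true))
    exact (Primrec.eq.comp (Primrec.list_length.comp h1)
      (primrec_blockMax.comp (Primrec.fst.comp Primrec.snd))).and
      ((primrecPred_mem_patternSet.comp h1).not.or
        ((PrimrecRel.list_isPrefix.comp h1 h2).and ((Primrec.eq.comp h1 h2).not.and h3)))
  refine (Primrec.nat_lt.comp Primrec.fst hi).and (PrimrecPred.and ?_ (PrimrecPred.and ?_ ?_))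
  · exact PrimrecPred.list_nodup.comp (Primrec.list_map hY (Primrec.fst.comp Primrec.snd).to₂)
  · exact hR.forall_mem_list.comp hY
      (hi.pair (Primrec.fst.comp (Primrec.snd.comp Primrec.snd)))
  · exact Primrec.nat_le.comp (Primrec.two_pow.comp (primrec_blockMax.comp hi))
      (Primrec.nat_add.comp (Primrec.list_length.comp hY)
        (Primrec.two_pow.comp (Primrec.nat_sub.comp (primrec_blockMax.comp hi)
          (Primrec.nat_add.comp (Primrec.nat_double.comp Primrec.fst) (Primrec.const 4)))))

theorem exists_isCertificate {T : Set (List Bool)} {e : Code}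
    (he : ∀ y, y ∈ T ↔ ∃ t, (e.evaln t (encode y)).isSome) {c i : ℕ} (hci : c < i)
    {Y : Finset (List Bool)} (hY : ∀ z ∈ Y, z.length = blockMax i ∧ IsBlocked T z)
    (hcard : 2 ^ blockMax i ≤ Y.card + 2 ^ (blockMax i - (2 * c + 4))) :
    ∃ p, IsCertificate e c p := by
  have key : ∀ z ∈ Y, ∃ (y : List Bool) (t : ℕ), z ∉ patternSet ∨
      z <+: y ∧ z ≠ y ∧ (e.evaln t (encode y)).isSome := by
    intro z hz
    rcases (hY z hz).2 with h | ⟨y, hy, h1, h2⟩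
    · exact ⟨[], 0, Or.inl h⟩
    · obtain ⟨t, ht⟩ := (he y).1 hy
      exact ⟨y, t, Or.inr ⟨h1, h2, ht⟩⟩
  choose! y t hyt using key
  -- The supremum is a common time bound for the finitely many computations.
  refine ⟨(i, Y.sup t, Y.toList.map fun z => (z, y z)), hci, ?_, ?_, by simpa using hcard⟩
  · simpa [Function.comp_def] using Y.nodup_toList
  · intro w hw
    obtain ⟨z, hz, rfl⟩ := List.mem_map.1 hw
    rw [Finset.mem_toList] at hz
    refine ⟨(hY z hz).1, (hyt z hz).imp_right fun h => ⟨h.1, h.2.1, ?_⟩⟩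
    obtain ⟨x, hx⟩ := Option.isSome_iff_exists.1 h.2.2
    exact Option.isSome_iff_exists.2 ⟨x, Code.evaln_mono (Finset.le_sup hz) hx⟩

theorem IsCertificate.exists_finset {T : Set (List Bool)} {e : Code}
    (he : ∀ y, y ∈ T ↔ ∃ t, (e.evaln t (encode y)).isSome) {c : ℕ}
    {p : ℕ × ℕ × List (List Bool × List Bool)} (hp : IsCertificate e c p) :
    ∃ Y : Finset (List Bool), (∀ z ∈ Y, z.length = blockMax p.1 ∧ IsBlocked T z) ∧
      2 ^ blockMax p.1 ≤ Y.card + 2 ^ (blockMax p.1 - (2 * c + 4)) := by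
  obtain ⟨-, hnd, hY, hcard⟩ := hp
  refine ⟨(p.2.2.map Prod.fst).toFinset, fun z hz => ?_, ?_⟩
  · obtain ⟨w, hw, rfl⟩ := List.mem_map.1 (List.mem_toFinset.1 hz)
    exact ⟨(hY w hw).1, (hY w hw).2.imp_right fun h => ⟨w.2, (he _).2 ⟨_, h.2.2⟩, h.1, h.2.1⟩⟩
  · rwa [List.toFinset_card_of_nodup hnd, List.length_map]

/-! ### The main result -/

/-- The domain of an optimal prefix-free decompressor meets all late blocks. -/
theorem IsOptimalPrefixFreeDecompressor.exists_mem_block {D : List Bool →. List Bool}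
    (hD : IsOptimalPrefixFreeDecompressor D) :
    ∃ K, ∀ i ≥ K, ∃ y ∈ D.Dom, blockIndex y.length = i := by
  -- The slack `i` absorbs the constant `c` once `i ≥ c`, so the descriptions do not exceed the top
  -- length.
  obtain ⟨c, hc⟩ := hD.exists_pow_le_card (h := fun i => Part.some (blockMax i - i))
    (Primrec.to_comp (Primrec.nat_sub.comp primrec_blockMax Primrec.id))
  refine ⟨c, fun i hi => ?_⟩
  by_contra! hno
  have hmax : blockMax i = blockMin i + 8 * i + 3 := rfl
  have h := hc i _ (Part.mem_some _) (by omega) (shortBitStrings (blockMin i)) fun y hy hlen => by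
    rw [mem_shortBitStrings]
    by_contra hge
    exact hno y hy (blockIndex_eq_iff.2 (by omega))
  have h1 : 2 ^ blockMin i ≤ 2 ^ (blockMax i - i - i - 1) := Nat.pow_le_pow_right two_pos (by omega)
  have h2 := card_shortBitStrings_lt (blockMin i)
  omega

theorem not_isOptimalPrefixFreeDecompressor_of_dom_subset_patternSet
    {D : List Bool →. List Bool} (hD : IsOptimalPrefixFreeDecompressor D) :
    ¬ D.Dom ⊆ patternSet := by
  classical
  intro hT
  obtain ⟨K, hK⟩ := hD.exists_mem_block
  obtain ⟨e, he⟩ := hD.isPrefixFreeDecompressor.partrec.exists_code_dom_iff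
  obtain ⟨g, hg, hgdom, hgcert⟩ := exists_partrec_selector (primrecRel_isCertificate e)
  -- The requests are defined for every `k` before the constant `c` is known; the tag `k = c` is
  -- then used.
  obtain ⟨c, hc⟩ := hD.exists_pow_le_card
    (h := fun k => (g k).map fun p => blockMax p.1 - k)
    (hg.map (Primrec.to_comp (Primrec.nat_sub.comp
      (primrec_blockMax.comp (Primrec.fst.comp Primrec.snd)) Primrec.fst)))
  obtain ⟨i, hi, hcard⟩ := exists_two_pow_le_card_filter_isBlocked hT hK (c + 1) (2 * c + 4)
  obtain ⟨p, hp⟩ := hgdom c (exists_isCertificate he hi (fun z hz => by simpa using hz) hcard)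
  have hcert := hgcert c p hp
  obtain ⟨Y, hY, hYcard⟩ := hcert.exists_finset he
  have hcp : c < p.1 := hcert.1
  have hmax : blockMax p.1 = blockMin p.1 + 8 * p.1 + 3 := rfl
  set S : Finset (List Bool) := (shortBitStrings (blockMax p.1 + 1)).filter fun y =>
    y ∈ D.Dom ∧ blockIndex y.length = p.1 with hS
  have hSY := card_add_card_le_of_isBlocked hT hD.isPrefixFreeDecompressor.prefixFree
    (S := S) (fun y hy => (Finset.mem_filter.1 hy).2) hY
  have h := hc c _ (Part.mem_map _ hp) (by omega) (shortBitStrings (blockMin p.1) ∪ S)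
    fun y hy hlen => by
      rw [Finset.mem_union, hS, Finset.mem_filter, mem_shortBitStrings, mem_shortBitStrings,
        blockIndex_eq_iff]
      by_cases hlt : y.length < blockMin p.1
      · exact Or.inl hlt
      · exact Or.inr ⟨by omega, hy, by omega, by omega⟩
  have h1 := Finset.card_union_le (shortBitStrings (blockMin p.1)) S
  have h2 := card_shortBitStrings_lt (blockMin p.1)
  have h3 : 2 ^ blockMin p.1 ≤ 2 ^ (blockMax p.1 - (2 * c + 4)) :=
    Nat.pow_le_pow_right two_pos (by omega)
  -- Eight units are requested, but the strings below the block and those of `S` supply at most one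
  -- unit each.
  have h4 : 2 ^ (blockMax p.1 - c - c - 1) = 8 * 2 ^ (blockMax p.1 - (2 * c + 4)) := by
    rw [show blockMax p.1 - c - c - 1 = blockMax p.1 - (2 * c + 4) + 3 by omega, pow_add]
    ring
  omega

theorem lemma1 :
    ∃ A : Set (List Bool), ComputablePred (fun x : List Bool => x ∈ A) ∧
      (∀ n : ℕ, (1 / 3 : ℝ) * 2 ^ n ≤ ({x : List Bool | x ∈ A ∧ x.length = n}.ncard : ℝ)) ∧
      ¬ ∃ D : List Bool →. List Bool, IsOptimalPrefixFreeDecompressor D ∧ D.Dom ⊆ A := by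
  refine ⟨patternSet, ?_, third_le_ncard_patternSet, ?_⟩
  · obtain ⟨inst, h⟩ := primrecPred_mem_patternSet
    exact ⟨inst, h.to_comp⟩
  · rintro ⟨D, hD, hdom⟩
    exact not_isOptimalPrefixFreeDecompressor_of_dom_subset_patternSet hD hdom
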